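/- Let $\ell\le k\le m\le n$ be positive integers, write $[n]=\{1,\dots,n\}$ and $\binom{[n]}{j}=\{A\subseteq[n]:|A|=j\}$, and let $\mathcal F\subseteq\binom{[n]}{k}$ and $\mathcal G\subseteq\binom{[n]}{m}$ be families whose cross intersections forbid $\ell$, that is, $|A\cap B|\ne\ell$ for every $A\in\mathcal F$ and every $B\in\mathcal G$. (i) If $k\le\frac n2$ and $m\le n-k$, then, setting $t:=\min\{\ell,k-\ell\}$, we have $$\frac{|\mathcal F|}{\binom nk}\cdot\frac{|\mathcal G|}{\binom nm}\le 50\,\sqrt{\frac{k(n-k)m(n-m)}{n^2}}\;\exp\Big(-\frac{t^2}{58^2\,k}\Big).$$ (ii) If $k\le\frac n2\le n-k<m\le n-k+\ell$, then, setting $\bar t:=\min\{k-\ell,\,n-m-(k-\ell)\}$, we have $$\frac{|\mathcal F|}{\binom nk}\cdot\frac{|\mathcal G|}{\binom nm}\le 50\,\sqrt{\frac{k(n-k)m(n-m)}{n^2}}\;\exp\Big(-\frac{\bar t^{\,2}}{58^2\,(n-m)}\Big),$$ where for $m=n$ (which forces $k=\ell$ and $\bar t=0$) the exponent $0/0$ is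 read as $0$, so that the right-hand side is $0$. -/

import Mathlib

/-- `Forbid n L F G`: the cross intersections of the families `F`, `G` of subsets of an
`n`-element set forbid `L`, that is, `|A ∩ B| ∉ L` for all `A ∈ F` and `B ∈ G`. -/
def Forbid (n : ℕ) (L : Set ℕ) (F G : Finset (Finset (Fin n))) : Prop :=
  ∀ A ∈ F, ∀ B ∈ G, (A ∩ B).card ∉ L

/-! Replace the uniform layers by the product measures μ_p, μ_q with p = k/n, q = m/n; then G lies
in the exceptional set of F for the value ℓ. The cube allows induction on coordinates once ℓ is
relaxed to an interval [a, b]: `cubeMeasure_exceptional_mul_le` bounds μ_q(exceptional) μ_p(F) by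
e^{κa} C^n + e^{-κb} C'^n, where C = 1 - κp + O(κ²p) and C' = 1 + O(κ²p).

Let F₀, F₁ be the sections of F over the first coordinate. The sections of the exceptional set are
exceptional for F₀ ∪ F₁, F₀, F₁ or F₀ ∩ F₁, with the interval unchanged, shifted or widened.
`step_inequality` shows that, whatever the measures of these four sets, some combination closes the
induction.

Taking a = b = ℓ and optimising κ gives 2 exp(-t²/(3200k)). By Stirling, the k-layer has μ_p-measure
at least 1/(3√(k(n-k)/n)), and likewise for m; returning to uniform densities therefore costs the
square root. Part (ii) follows from the same bound after complementing G and exchanging the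
families. -/

/-! ### The one-coordinate inequality -/

theorem exp_neg_le_quadratic {κ : ℝ} (hκ : 0 ≤ κ) (hκ' : κ ≤ 1) :
    Real.exp (-κ) ≤ 1 - κ + κ ^ 2 := by
  have := Real.abs_exp_sub_one_sub_id_le (x := -κ) (by rwa [abs_neg, abs_of_nonneg hκ])
  have := (abs_le.1 this).2
  linarith [neg_sq κ]

theorem exp_le_quadratic {κ : ℝ} (hκ : 0 ≤ κ) (hκ' : κ ≤ 1) :
    Real.exp κ ≤ 1 + κ + κ ^ 2 := by
  have := Real.abs_exp_sub_one_sub_id_le (x := κ) (by rwa [abs_of_nonneg hκ])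
  have := (abs_le.1 this).2
  linarith

/-- Here and below 1 + e, 1 + f, 1 + g, 1 - δ are the measures of F₀, F₁, F₀ ∪ F₁, F₀ ∩ F₁ relative
to F. If f ≥ 2κ, the gain 1 + f pays for the factor e^κ that shifting puts on B. -/
theorem step_inequality_shift {p q κ A B H₀ H₁ f g : ℝ} (hp : 0 < p) (hp1 : p ≤ 1)
    (hq0 : 0 ≤ q) (hq1 : q ≤ 1) (hκ : 0 ≤ κ) (hκ' : κ ≤ 1 / 1000) (hA : 0 ≤ A) (hB : 0 ≤ B)
    (hfg : f ≤ g) (hf : 2 * κ ≤ f) (h₀ : H₀ * (1 + g) ≤ A + B)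
    (h₂ : H₁ * (1 + f) ≤ A * Real.exp (-κ) + B * Real.exp κ) :
    (1 - q) * H₀ + q * H₁ ≤
      A * (1 - κ * p + 800 * κ ^ 2 * p) + B * (1 + 800 * κ ^ 2 * p) := by
  have hH₀ : H₀ ≤ A * (1 - κ) + B := by
    refine le_of_mul_le_mul_right (h₀.trans ?_) (by linarith : 0 < 1 + g)
    have e1 : A * 1 ≤ A * ((1 - κ) * (1 + g)) := mul_le_mul_of_nonneg_left (by nlinarith) hA
    have e2 : B * 1 ≤ B * (1 + g) := mul_le_mul_of_nonneg_left (by linarith) hB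
    linarith
  have hH₁ : H₁ ≤ A * (1 - κ) + B := by
    refine le_of_mul_le_mul_right (h₂.trans ?_) (by linarith : 0 < 1 + f)
    have e1 := mul_le_mul_of_nonneg_left (exp_neg_le_quadratic hκ (by linarith)) hA
    have e2 := mul_le_mul_of_nonneg_left (exp_le_quadratic hκ (by linarith)) hB
    have e3 : A * (1 - κ + κ ^ 2) ≤ A * ((1 - κ) * (1 + f)) :=
      mul_le_mul_of_nonneg_left (by nlinarith) hA
    have e4 : B * (1 + κ + κ ^ 2) ≤ B * (1 + f) :=
      mul_le_mul_of_nonneg_left (by nlinarith) hB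
    linarith
  have e1 := mul_le_mul_of_nonneg_left hH₀ (sub_nonneg.2 hq1)
  have e2 := mul_le_mul_of_nonneg_left hH₁ hq0
  have hκp : κ * p ≤ κ * 1 := mul_le_mul_of_nonneg_left hp1 hκ
  have hκ2p : 0 ≤ κ ^ 2 * p := by positivity
  have e3 : A * (1 - κ) ≤ A * (1 - κ * p + 800 * κ ^ 2 * p) :=
    mul_le_mul_of_nonneg_left (by linarith) hA
  have e4 : 0 ≤ B * (800 * κ ^ 2 * p) := by positivity
  linarith

/-- The weight q of H₁ is split into q - p for the F₀ bound and p for the widened one. The linear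
terms then collapse to -(1 - p - q)(g - e) ≤ 0, leaving an error O(κ²p). -/
theorem widen_coefficient_le {p q κ e f g δ : ℝ} (hp : 0 < p) (hp2 : p ≤ 1 / 2)
    (hpq : p ≤ q) (hq : q ≤ 1 - p) (hκ : 0 ≤ κ) (hκ' : κ ≤ 1 / 1000)
    (hef : (1 - p) * e + p * f = 0) (hg : g = δ + e + f) (heg : e ≤ g) (hg0 : 0 ≤ g)
    (hδ0 : 0 ≤ δ) (hδ : δ ≤ 4 * κ) (hf : f < 2 * κ) (he_low : -(4 * κ * p) ≤ e)
    (he_up : e ≤ 8 * κ * p) :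
    (1 - q) * (1 - g + g ^ 2) + (q - p) * (1 - e + 2 * e ^ 2) + p * (1 + δ + 2 * δ ^ 2) ≤
      1 + 300 * (κ ^ 2 * p) := by
  have hκ2p : 0 ≤ κ ^ 2 * p := by positivity
  have hκp : 0 ≤ κ * p := by positivity
  have hκp' : κ * p ≤ κ * (1 / 2) := mul_le_mul_of_nonneg_left hp2 hκ
  have hg_up : g ≤ 8 * κ := by
    have : g ≤ 8 * κ ∨ 0 < e := by
      by_contra! h
      linarith
    rcases this with h | h
    · exact h
    · have : f ≤ 0 := by nlinarith
      linarith
  have he2 : e ^ 2 ≤ 64 * κ ^ 2 * p ^ 2 := by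
    have : |e| ≤ 8 * κ * p := abs_le.2 ⟨by linarith, he_up⟩
    calc e ^ 2 = |e| ^ 2 := (sq_abs e).symm
      _ ≤ (8 * κ * p) ^ 2 := pow_le_pow_left₀ (abs_nonneg e) this 2
      _ = _ := by ring
  have he2' : e ^ 2 ≤ 32 * (κ ^ 2 * p) := by
    have := mul_le_mul_of_nonneg_left hp2 hκ2p
    linarith
  have hg2 : g ^ 2 ≤ (g - e) + 64 * (κ ^ 2 * p) := by
    have : (g - e) ^ 2 ≤ (g - e) * (1 / 2) := by
      rw [sq]; exact mul_le_mul_of_nonneg_left (by linarith) (by linarith)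
    linarith [sq_nonneg (g - 2 * e)]
  have hg2' : g ^ 2 ≤ (8 * κ) ^ 2 := pow_le_pow_left₀ hg0 hg_up 2
  have hδ2 : δ ^ 2 ≤ (4 * κ) ^ 2 := pow_le_pow_left₀ hδ0 hδ 2
  -- Split 1 - q = (1 - p - q) + p: on the first piece the negative linear term absorbs g²; on the
  -- second, g² ≤ 64κ² suffices because of the factor p.
  have t1 := mul_le_mul_of_nonneg_left hg2 (by linarith : 0 ≤ 1 - p - q)
  have t2 := mul_le_mul_of_nonneg_left hg2' hp.le
  have t3 := mul_le_mul_of_nonneg_left he2' (by linarith : 0 ≤ q - p)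
  have t4 := mul_le_mul_of_nonneg_left hδ2 hp.le
  have t5 : (1 - p - q) * (κ ^ 2 * p) + (q - p) * (κ ^ 2 * p) ≤ 1 * (κ ^ 2 * p) := by
    rw [← add_mul]; exact mul_le_mul_of_nonneg_right (by linarith) hκ2p
  have t6 : 0 ≤ (q - p) * (κ ^ 2 * p) := mul_nonneg (by linarith) hκ2p
  have key : (1 - q) * (-g) + (q - p) * (-e) + p * δ = -((1 - p - q) * (g - e)) := by
    have : p * δ = p * g - p * e - p * f := by rw [hg]; ring
    rw [this]; linear_combination -hef
  linarith

theorem step_inequality_widen {p q κ A B H₀ H₁ e f g δ : ℝ} (hp : 0 < p) (hp2 : p ≤ 1 / 2)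
    (hpq : p ≤ q) (hq : q ≤ 1 - p) (hκ : 0 ≤ κ) (hκ' : κ ≤ 1 / 1000) (hA : 0 ≤ A) (hB : 0 ≤ B)
    (hef : (1 - p) * e + p * f = 0) (hg : g = δ + e + f) (heg : e ≤ g) (hg0 : 0 ≤ g)
    (hδ0 : 0 ≤ δ) (hδ : δ ≤ 4 * κ) (hf : f < 2 * κ)
    (he_low : -(4 * κ * p) ≤ e)
    (h₀ : H₀ * (1 + g) ≤ A + B) (h₁ : H₁ * (1 + e) ≤ A + B)
    (h₃ : H₁ * (1 - δ) ≤ A * Real.exp (-κ) + B) :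
    (1 - q) * H₀ + q * H₁ ≤
      A * (1 - κ * p + 800 * κ ^ 2 * p) + B * (1 + 800 * κ ^ 2 * p) := by
  have hAB : 0 ≤ A + B := add_nonneg hA hB
  have hκ2p : 0 ≤ κ ^ 2 * p := by positivity
  have hκp : 0 ≤ κ * p := by positivity
  have hκp' : κ * p ≤ κ * (1 / 2) := mul_le_mul_of_nonneg_left hp2 hκ
  have hκ2 : κ ^ 2 ≤ κ := by nlinarith
  have he_up : e ≤ 8 * κ * p := by
    have h1 : (1 - p) * e ≤ p * δ := by nlinarith
    have h2 : p * δ ≤ p * (4 * κ) := mul_le_mul_of_nonneg_left hδ hp.le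
    by_contra! h
    have : (1 - p) * (8 * κ * p) < (1 - p) * e := mul_lt_mul_of_pos_left h (by linarith)
    nlinarith
  have hH₀g : H₀ ≤ (A + B) * (1 - g + g ^ 2) := by
    refine le_of_mul_le_mul_right (h₀.trans ?_) (by linarith : 0 < 1 + g)
    have : 0 ≤ (A + B) * g ^ 3 := by positivity
    linarith
  have hH₁e : H₁ ≤ (A + B) * (1 - e + 2 * e ^ 2) := by
    refine le_of_mul_le_mul_right (h₁.trans ?_) (by linarith : 0 < 1 + e)
    have : 0 ≤ (A + B) * (e ^ 2 * (1 + 2 * e)) :=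
      mul_nonneg hAB (mul_nonneg (sq_nonneg e) (by linarith))
    linarith
  have hH₁δ : H₁ ≤ (A * (1 - κ + κ ^ 2) + B) * (1 + δ + 2 * δ ^ 2) := by
    have hAB' : 0 ≤ A * (1 - κ + κ ^ 2) + B :=
      add_nonneg (mul_nonneg hA (by linarith [sq_nonneg κ])) hB
    refine le_of_mul_le_mul_right (h₃.trans ?_) (by linarith : 0 < 1 - δ)
    have : 0 ≤ (A * (1 - κ + κ ^ 2) + B) * (δ ^ 2 * (1 - 2 * δ)) :=
      mul_nonneg hAB' (mul_nonneg (sq_nonneg δ) (by linarith))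
    have e1 := mul_le_mul_of_nonneg_left (exp_neg_le_quadratic hκ (by linarith)) hA
    linarith
  have hcoef := widen_coefficient_le hp hp2 hpq hq hκ hκ' hef hg heg hg0 hδ0 hδ hf he_low he_up
  have hcoefA : κ * p - κ ^ 2 * p ≤ p * (1 + δ + 2 * δ ^ 2) * (κ - κ ^ 2) := by
    have : 0 ≤ p * (δ + 2 * δ ^ 2) * (κ - κ ^ 2) :=
      mul_nonneg (by positivity) (by linarith)
    linarith
  have t1 := mul_le_mul_of_nonneg_left hH₀g (by linarith : 0 ≤ 1 - q)
  have t2 := mul_le_mul_of_nonneg_left hH₁e (by linarith : 0 ≤ q - p)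
  have t3 := mul_le_mul_of_nonneg_left hH₁δ hp.le
  have t4 := mul_le_mul_of_nonneg_left hcoef hAB
  have t5 := mul_le_mul_of_nonneg_left hcoefA hA
  have t6 := mul_nonneg hA hκ2p
  have t7 := mul_nonneg hB hκ2p
  linarith

/-- If δ > 4κ, the sections differ enough that the union and F₀ bounds alone contract A + B as a
whole. -/
theorem keep_coefficient_le {p q κ e f g δ : ℝ} (hp : 0 < p) (hp2 : p ≤ 1 / 2)
    (hpq : p ≤ q) (hq : q ≤ 1 - p) (hκ : 0 ≤ κ) (hκ' : κ ≤ 1 / 1000)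
    (hef : (1 - p) * e + p * f = 0) (hg : g = δ + e + f) (heg : e ≤ g) (hg0 : 0 ≤ g)
    (hδ : 4 * κ < δ) (hf : f < 2 * κ) (he_low : -(4 * κ * p) ≤ e) :
    (1 - q) * (1 / (1 + g)) + q * (1 / (1 + e)) ≤ 1 - κ * p := by
  have hκp : 0 ≤ κ * p := by positivity
  have hκp' : κ * p ≤ κ * (1 / 2) := mul_le_mul_of_nonneg_left hp2 hκ
  have he : 0 < 1 + e := by linarith
  rcases le_or_gt 0 e with he0 | he0
  · have hmono : 1 / (1 + g) ≤ 1 / (1 + e) := one_div_le_one_div_of_le he (by linarith)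
    -- As 1/(1+g) ≤ 1/(1+e), the worst case is q = 1 - p.
    have hswap : (1 - q) * (1 / (1 + g)) + q * (1 / (1 + e)) ≤
        p * (1 / (1 + g)) + (1 - p) * (1 / (1 + e)) := by nlinarith
    refine hswap.trans ?_
    rcases le_or_gt g 1 with hg1 | hg1
    · have h1 : 1 / (1 + g) ≤ 1 - g / 2 := by
        rw [div_le_iff₀ (by linarith)]; nlinarith
      have h2 : 1 / (1 + e) ≤ 1 - e / 2 := by
        rw [div_le_iff₀ he]; nlinarith
      have t1 := mul_le_mul_of_nonneg_left h1 hp.le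
      have t2 := mul_le_mul_of_nonneg_left h2 (by linarith : 0 ≤ 1 - p)
      have t3 := mul_le_mul_of_nonneg_left hδ.le hp.le
      have t4 : 0 ≤ p * e := by positivity
      rw [hg] at t1
      rw [hg]
      linarith
    · have h1 : 1 / (1 + g) ≤ 1 / 2 := one_div_le_one_div_of_le (by norm_num) (by linarith)
      have h2 : 1 / (1 + e) ≤ 1 := by
        rw [div_le_one he]; linarith
      have t1 := mul_le_mul_of_nonneg_left h1 hp.le
      have t2 := mul_le_mul_of_nonneg_left h2 (by linarith : 0 ≤ 1 - p)
      have t3 := mul_le_mul_of_nonneg_left hκ' hp.le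
      linarith
  · have hfe : 0 ≤ f + e := by
      have : 0 ≤ p * (f + e) := by nlinarith
      exact nonneg_of_mul_nonneg_right this hp
    have h1 : 1 / (1 + g) ≤ 1 - 19 / 5 * κ := by
      rw [div_le_iff₀ (by linarith)]; nlinarith
    have h2 : 1 / (1 + e) ≤ 1 - 5 / 4 * e := by
      rw [div_le_iff₀ he]; nlinarith
    have t1 := mul_le_mul_of_nonneg_left h1 (by linarith : 0 ≤ 1 - q)
    have t2 := mul_le_mul_of_nonneg_left h2 (by linarith : 0 ≤ q)
    have t3 : q * (-e) ≤ (1 - p) * (-e) := mul_le_mul_of_nonneg_right hq (by linarith)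
    have t4 : p * κ ≤ (1 - q) * κ := mul_le_mul_of_nonneg_right (by linarith) hκ
    have t5 : p * f ≤ p * (2 * κ) := mul_le_mul_of_nonneg_left hf.le hp.le
    linarith

/-- The one-coordinate estimate behind the induction: the four hypotheses on `H₀` and `H₁` bound
the measures of the exceptional sets after taking the union, keeping one half, shifting the
interval, and widening the interval, respectively. -/
theorem step_inequality {p q κ A B H₀ H₁ x₀ x₁ U I : ℝ} (hp : 0 < p) (hp2 : p ≤ 1 / 2)
    (hpq : p ≤ q) (hq : q ≤ 1 - p) (hκ : 0 ≤ κ) (hκ' : κ ≤ 1 / 1000) (hA : 0 ≤ A) (hB : 0 ≤ B)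
    (hv : (1 - p) * x₀ + p * x₁ = 1) (hUI : U + I = x₀ + x₁)
    (hI₀ : I ≤ x₀) (hI₁ : I ≤ x₁) (h₀ : H₀ * U ≤ A + B) (h₁ : H₁ * x₀ ≤ A + B)
    (h₂ : H₁ * x₁ ≤ A * Real.exp (-κ) + B * Real.exp κ)
    (h₃ : H₁ * I ≤ A * Real.exp (-κ) + B) :
    (1 - q) * H₀ + q * H₁ ≤
      A * (1 - κ * p + 800 * κ ^ 2 * p) + B * (1 + 800 * κ ^ 2 * p) := by
  have hAB : 0 ≤ A + B := add_nonneg hA hB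
  obtain ⟨e, rfl⟩ : ∃ e, x₀ = 1 + e := ⟨x₀ - 1, by ring⟩
  obtain ⟨g, rfl⟩ : ∃ g, U = 1 + g := ⟨U - 1, by ring⟩
  obtain ⟨δ, rfl⟩ : ∃ δ, I = 1 - δ := ⟨1 - I, by ring⟩
  obtain ⟨f, rfl⟩ : ∃ f, x₁ = 1 + f := ⟨x₁ - 1, by ring⟩
  have hef : (1 - p) * e + p * f = 0 := by linarith
  have hg : g = δ + e + f := by linarith
  have heg : e ≤ g := by linarith
  have hfg : f ≤ g := by linarith
  have hg0 : 0 ≤ g := by nlinarith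
  have hδ0 : 0 ≤ δ := by nlinarith
  rcases le_or_gt (2 * κ) f with hf | hf
  · exact step_inequality_shift hp (by linarith) (by linarith) (by linarith) hκ hκ' hA hB hfg hf
      h₀ h₂
  have he_low : -(4 * κ * p) ≤ e := by
    by_contra! h
    have h1 : p * f ≤ p * (2 * κ) := mul_le_mul_of_nonneg_left hf.le hp.le
    have h2 : (1 - p) * e < (1 - p) * (-(4 * κ * p)) := mul_lt_mul_of_pos_left h (by linarith)
    have h3 : 1 / 2 * (4 * κ * p) ≤ (1 - p) * (4 * κ * p) :=
      mul_le_mul_of_nonneg_right (by linarith) (by positivity)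
    linarith
  rcases le_or_gt δ (4 * κ) with hδ | hδ
  · exact step_inequality_widen hp hp2 hpq hq hκ hκ' hA hB hef hg heg hg0 hδ0 hδ hf he_low
      h₀ h₁ h₃
  have hcoef := keep_coefficient_le hp hp2 hpq hq hκ hκ' hef hg heg hg0 hδ hf he_low
  have hκp : 0 ≤ κ * p := by positivity
  have hκ2p : 0 ≤ κ ^ 2 * p := by positivity
  have he : 0 < 1 + e := by nlinarith
  have hH₀ : H₀ ≤ (A + B) * (1 / (1 + g)) := by
    rw [mul_one_div]; exact (le_div_iff₀ (by linarith)).2 h₀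
  have hH₁ : H₁ ≤ (A + B) * (1 / (1 + e)) := by
    rw [mul_one_div]; exact (le_div_iff₀ he).2 h₁
  have t1 := mul_le_mul_of_nonneg_left hH₀ (by linarith : 0 ≤ 1 - q)
  have t2 := mul_le_mul_of_nonneg_left hH₁ (by linarith : 0 ≤ q)
  have t3 := mul_le_mul_of_nonneg_left hcoef hAB
  have t6 := mul_nonneg hA hκ2p
  have t7 := mul_nonneg hB hκ2p
  have t8 := mul_nonneg hB hκp
  linarith

/-! ### Product measures and exceptional sets -/

/-- The product measure on the discrete cube in which each coordinate is `true` with weight `p`. -/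
noncomputable def cubeMeasure (p : ℝ) {n : ℕ} (S : Set (Fin n → Bool)) : ℝ :=
  ∑ x, S.indicator (fun x => ∏ i, if x i then p else 1 - p) x

/-- The section of `S` over the value `b` of the first coordinate. -/
def cubeSection {n : ℕ} (b : Bool) (S : Set (Fin (n + 1) → Bool)) : Set (Fin n → Bool) :=
  {x | Fin.cons b x ∈ S}

/-- The number of coordinates at which both points are `true`. -/
def commonCount {n : ℕ} (x y : Fin n → Bool) : ℤ :=
  ∑ i, if x i && y i then 1 else 0

/-- The points which have no common count in `[a, b]` with a point of `F`. -/
def exceptional {n : ℕ} (F : Set (Fin n → Bool)) (a b : ℤ) : Set (Fin n → Bool) :=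
  {y | ∀ x ∈ F, ¬ (a ≤ commonCount x y ∧ commonCount x y ≤ b)}

theorem cubeMeasure_succ (p : ℝ) {n : ℕ} (S : Set (Fin (n + 1) → Bool)) :
    cubeMeasure p S =
      (1 - p) * cubeMeasure p (cubeSection false S) + p * cubeMeasure p (cubeSection true S) := by
  classical
  unfold cubeMeasure
  rw [← (Fin.consEquiv fun _ => Bool).sum_comp, Fintype.sum_prod_type, Fintype.sum_bool, add_comm,
    Finset.mul_sum, Finset.mul_sum]
  simp [Set.indicator_apply, cubeSection, Fin.consEquiv, Fin.prod_univ_succ]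

theorem cubeMeasure_weight_nonneg {p : ℝ} (hp : 0 ≤ p) (hp1 : p ≤ 1) {n : ℕ} (x : Fin n → Bool) :
    0 ≤ ∏ i, if x i then p else 1 - p :=
  Finset.prod_nonneg fun i _ => by split_ifs <;> linarith

theorem cubeMeasure_mono {p : ℝ} (hp : 0 ≤ p) (hp1 : p ≤ 1) {n : ℕ} {S T : Set (Fin n → Bool)}
    (h : S ⊆ T) : cubeMeasure p S ≤ cubeMeasure p T :=
  Finset.sum_le_sum fun x _ =>
    Set.indicator_le_indicator_of_subset h (cubeMeasure_weight_nonneg hp hp1) x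

theorem cubeMeasure_nonneg {p : ℝ} (hp : 0 ≤ p) (hp1 : p ≤ 1) {n : ℕ} (S : Set (Fin n → Bool)) :
    0 ≤ cubeMeasure p S :=
  Finset.sum_nonneg fun x _ => Set.indicator_nonneg
    (fun x _ => cubeMeasure_weight_nonneg hp hp1 x) x

theorem cubeMeasure_union_add_inter (p : ℝ) {n : ℕ} (S T : Set (Fin n → Bool)) :
    cubeMeasure p (S ∪ T) + cubeMeasure p (S ∩ T) = cubeMeasure p S + cubeMeasure p T := by
  unfold cubeMeasure
  rw [← Finset.sum_add_distrib, ← Finset.sum_add_distrib]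
  exact Finset.sum_congr rfl fun x _ => Set.indicator_union_add_inter_apply _ S T x

theorem cubeMeasure_zero_le_one (p : ℝ) (S : Set (Fin 0 → Bool)) : cubeMeasure p S ≤ 1 := by
  classical
  simp only [cubeMeasure, Set.indicator_apply, Finset.univ_eq_empty, Finset.prod_empty,
    Fintype.sum_unique]
  split_ifs <;> norm_num

theorem commonCount_cons {n : ℕ} (b c : Bool) (x y : Fin n → Bool) :
    commonCount (Fin.cons b x : Fin (n + 1) → Bool) (Fin.cons c y) =
      (if b && c then 1 else 0) + commonCount x y := by
  simp only [commonCount, Fin.sum_univ_succ, Fin.cons_zero, Fin.cons_succ]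

theorem section_false_exceptional_subset {n : ℕ} (F : Set (Fin (n + 1) → Bool)) (a b : ℤ) :
    cubeSection false (exceptional F a b) ⊆
      exceptional (cubeSection false F ∪ cubeSection true F) a b := by
  rintro y hy x (hx | hx)
  · simpa [commonCount_cons] using hy _ hx
  · simpa [commonCount_cons] using hy _ hx

theorem section_true_exceptional_subset_keep {n : ℕ} (F : Set (Fin (n + 1) → Bool)) (a b : ℤ) :
    cubeSection true (exceptional F a b) ⊆ exceptional (cubeSection false F) a b := by
  intro y hy x hx
  simpa [commonCount_cons] using hy _ hx

theorem section_true_exceptional_subset_shift {n : ℕ} (F : Set (Fin (n + 1) → Bool)) (a b : ℤ) :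
    cubeSection true (exceptional F a b) ⊆
      exceptional (cubeSection true F) (a - 1) (b - 1) := by
  intro y hy x hx h
  refine hy _ hx ?_
  rw [commonCount_cons]
  simp only [Bool.and_self, if_true]
  omega

/-- For integers a ≤ b, the intervals [a - 1, b - 1] and [a, b] together cover [a - 1, b]. -/
theorem section_true_exceptional_subset_widen {n : ℕ} (F : Set (Fin (n + 1) → Bool)) {a b : ℤ}
    (hab : a ≤ b) :
    cubeSection true (exceptional F a b) ⊆
      exceptional (cubeSection false F ∩ cubeSection true F) (a - 1) b := by
  intro y hy x hx h
  have h0 := section_true_exceptional_subset_keep F a b hy x hx.1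
  have h1 := section_true_exceptional_subset_shift F a b hy x hx.2
  omega

/-! ### Induction on the dimension -/

theorem cubeMeasure_exceptional_mul_le {p q κ : ℝ} (hp : 0 < p) (hp2 : p ≤ 1 / 2)
    (hpq : p ≤ q) (hq : q ≤ 1 - p) (hκ : 0 ≤ κ) (hκ' : κ ≤ 1 / 1000) {n : ℕ}
    (F : Set (Fin n → Bool)) {a b : ℤ} (hab : a ≤ b) :
    cubeMeasure q (exceptional F a b) * cubeMeasure p F ≤
      Real.exp (κ * a) * (1 - κ * p + 800 * κ ^ 2 * p) ^ n +
        Real.exp (-(κ * b)) * (1 + 800 * κ ^ 2 * p) ^ n := by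
  have hp0 := hp.le
  have hp1 : p ≤ 1 := by linarith
  have hq0 : 0 ≤ q := by linarith
  have hq1 : q ≤ 1 := by linarith
  have hC : 0 ≤ 1 - κ * p + 800 * κ ^ 2 * p := by
    have : κ * p ≤ 1 * 1 := mul_le_mul (by linarith) hp1 hp0 (by norm_num)
    have : 0 ≤ 800 * κ ^ 2 * p := by positivity
    linarith
  have hC' : 0 ≤ 1 + 800 * κ ^ 2 * p := by positivity
  induction n generalizing a b with
  | zero =>
    simp only [pow_zero, mul_one]
    have hX := (Real.exp_pos (κ * a)).le
    have hY := (Real.exp_pos (-(κ * b))).le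
    by_cases hE : exceptional F a b = ∅ ∨ F = ∅
    · have : cubeMeasure q (exceptional F a b) * cubeMeasure p F = 0 := by
        rcases hE with h | h <;> rw [h] <;> simp [cubeMeasure]
      linarith
    push Not at hE
    obtain ⟨⟨y, hy⟩, x, hx⟩ := hE
    have hxy := hy x hx
    have h0 : commonCount x y = 0 := by simp [commonCount]
    rw [h0] at hxy
    have hle : cubeMeasure q (exceptional F a b) * cubeMeasure p F ≤ 1 :=
      mul_le_one₀ (cubeMeasure_zero_le_one _ _) (cubeMeasure_nonneg hp0 hp1 _)
        (cubeMeasure_zero_le_one _ _)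
    -- The count 0 lies outside [a, b], so one exponential is at least 1.
    by_cases ha : 0 < a
    · have : 1 ≤ Real.exp (κ * a) :=
        Real.one_le_exp (mul_nonneg hκ (by exact_mod_cast ha.le))
      linarith
    · have hb : b ≤ 0 := by omega
      have : 1 ≤ Real.exp (-(κ * b)) := by
        refine Real.one_le_exp (neg_nonneg.2 (mul_nonpos_of_nonneg_of_nonpos hκ ?_))
        exact_mod_cast hb
      linarith
  | succ n ih =>
    set F₀ := cubeSection false F with hF₀
    set F₁ := cubeSection true F with hF₁
    set C := 1 - κ * p + 800 * κ ^ 2 * p with hCdef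
    set C' := 1 + 800 * κ ^ 2 * p with hCdef'
    set A := Real.exp (κ * a) * C ^ n with hA
    set B := Real.exp (-(κ * b)) * C' ^ n with hB
    have hA0 : 0 ≤ A := by positivity
    have hB0 : 0 ≤ B := by positivity
    set v := cubeMeasure p F with hv
    have hv0 : 0 ≤ v := cubeMeasure_nonneg hp0 hp1 _
    have hvs : v = (1 - p) * cubeMeasure p F₀ + p * cubeMeasure p F₁ := cubeMeasure_succ p F
    have goal_eq : Real.exp (κ * a) * C ^ (n + 1) + Real.exp (-(κ * b)) * C' ^ (n + 1) =
        A * C + B * C' := by rw [hA, hB]; ring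
    rw [goal_eq]
    rcases hv0.eq_or_lt with h | hvpos
    · rw [← h, mul_zero]; positivity
    set H₀ := cubeMeasure q (cubeSection false (exceptional F a b)) with hH₀
    set H₁ := cubeMeasure q (cubeSection true (exceptional F a b)) with hH₁
    have bound {E : Set (Fin n → Bool)} {S : Set (Fin n → Bool)} {a' b' : ℤ} (hab' : a' ≤ b')
        (hE : E ⊆ exceptional S a' b') : cubeMeasure q E * v * (cubeMeasure p S / v) ≤
          Real.exp (κ * a') * C ^ n + Real.exp (-(κ * b')) * C' ^ n := by
      refine le_trans ?_ (ih S hab')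
      rw [mul_assoc, mul_div_cancel₀ _ hvpos.ne']
      exact mul_le_mul_of_nonneg_right (cubeMeasure_mono hq0 hq1 hE)
        (cubeMeasure_nonneg hp0 hp1 _)
    have h₀ := bound hab (section_false_exceptional_subset F a b)
    have h₁ := bound hab (section_true_exceptional_subset_keep F a b)
    have h₂ := bound (sub_le_sub_right hab 1) (section_true_exceptional_subset_shift F a b)
    have h₃ := bound (by omega) (section_true_exceptional_subset_widen F hab)
    have hexpa : Real.exp (κ * ((a - 1 : ℤ) : ℝ)) * C ^ n = A * Real.exp (-κ) := by
      rw [hA, mul_right_comm, ← Real.exp_add]; push_cast; ring_nf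
    have hexpb : Real.exp (-(κ * ((b - 1 : ℤ) : ℝ))) * C' ^ n = B * Real.exp κ := by
      rw [hB, mul_right_comm, ← Real.exp_add]; push_cast; ring_nf
    rw [hexpa] at h₂ h₃
    rw [hexpb] at h₂
    have key := step_inequality hp hp2 hpq hq hκ hκ' hA0 hB0
      (by field_simp; exact hvs.symm)
      (by rw [← add_div, ← add_div, cubeMeasure_union_add_inter])
      (div_le_div_of_nonneg_right
        (cubeMeasure_mono hp0 hp1 Set.inter_subset_left) hv0)
      (div_le_div_of_nonneg_right
        (cubeMeasure_mono hp0 hp1 Set.inter_subset_right) hv0) h₀ h₁ h₂ h₃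
    rw [cubeMeasure_succ]
    refine le_trans (le_of_eq ?_) key
    ring

theorem cubeMeasure_exceptional_mul_le_exp {k m n ℓ : ℕ} (hk : 0 < k) (hℓ : ℓ ≤ k) (hkm : k ≤ m)
    (hkn : 2 * k ≤ n) (hmn : m + k ≤ n) (F : Set (Fin n → Bool)) :
    cubeMeasure ((m : ℝ) / n) (exceptional F ℓ ℓ) * cubeMeasure ((k : ℝ) / n) F ≤
      2 * Real.exp (-((min (ℓ : ℝ) ((k : ℝ) - ℓ)) ^ 2 / (3200 * (k : ℝ)))) := by
  have hk' : (0 : ℝ) < k := by exact_mod_cast hk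
  have hkn' : 2 * (k : ℝ) ≤ n := by exact_mod_cast hkn
  have hmn' : (m : ℝ) + k ≤ n := by exact_mod_cast hmn
  have hkm' : (k : ℝ) ≤ m := by exact_mod_cast hkm
  have hℓ' : (ℓ : ℝ) ≤ k := by exact_mod_cast hℓ
  have hn : (0 : ℝ) < n := by linarith
  set t := min (ℓ : ℝ) ((k : ℝ) - ℓ) with ht
  have ht0 : 0 ≤ t := le_min (by positivity) (by linarith)
  have ht1 : t ≤ ℓ := min_le_left _ _
  have ht2 : t ≤ k - ℓ := min_le_right _ _
  -- This κ minimises -κt + 800κ²k, with minimum -t²/(3200k).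
  set κ := t / (1600 * k) with hκ
  have hκ0 : 0 ≤ κ := by positivity
  have hκ1 : κ ≤ 1 / 1000 := by
    rw [hκ, div_le_div_iff₀ (by positivity) (by norm_num)]; linarith
  have main := cubeMeasure_exceptional_mul_le (p := (k : ℝ) / n) (q := (m : ℝ) / n) (κ := κ)
    (by positivity) (by rw [div_le_div_iff₀ hn (by norm_num)]; linarith)
    (div_le_div_of_nonneg_right hkm' hn.le)
    (by rw [le_sub_iff_add_le, ← add_div, div_le_one hn]; exact hmn') hκ0 hκ1 F (le_refl (ℓ : ℤ))
  have hpn : (n : ℝ) * ((k : ℝ) / n) = k := mul_div_cancel₀ _ hn.ne'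
  have hsq : 800 * κ ^ 2 * k = t ^ 2 / (3200 * k) := by rw [hκ]; field_simp; ring
  have hlin : κ * t = 2 * (t ^ 2 / (3200 * k)) := by rw [hκ]; field_simp; ring
  have hpow (s : ℝ) (hs : 0 ≤ 1 + s) : (1 + s) ^ n ≤ Real.exp (n * s) := by
    rw [Real.exp_nat_mul]
    exact pow_le_pow_left₀ hs (by linarith [Real.add_one_le_exp s]) n
  have hp1 : (k : ℝ) / n ≤ 1 := by rw [div_le_one hn]; linarith
  have hκp : κ * ((k : ℝ) / n) ≤ 1 * 1 := mul_le_mul (by linarith) hp1 (by positivity) (by norm_num)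
  have hκ2p : 0 ≤ 800 * κ ^ 2 * ((k : ℝ) / n) := by positivity
  have hC := hpow (-(κ * ((k : ℝ) / n)) + 800 * κ ^ 2 * ((k : ℝ) / n)) (by linarith)
  have hC' := hpow (800 * κ ^ 2 * ((k : ℝ) / n)) (by linarith)
  have e1 : Real.exp (κ * ((ℓ : ℤ) : ℝ)) *
      (1 - κ * ((k : ℝ) / n) + 800 * κ ^ 2 * ((k : ℝ) / n)) ^ n ≤
      Real.exp (-(t ^ 2 / (3200 * k))) := by
    rw [show 1 - κ * ((k : ℝ) / n) + 800 * κ ^ 2 * ((k : ℝ) / n) =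
      1 + (-(κ * ((k : ℝ) / n)) + 800 * κ ^ 2 * ((k : ℝ) / n)) by ring]
    refine (mul_le_mul_of_nonneg_left hC (Real.exp_pos _).le).trans ?_
    rw [← Real.exp_add, Real.exp_le_exp]
    have : (n : ℝ) * (-(κ * ((k : ℝ) / n)) + 800 * κ ^ 2 * ((k : ℝ) / n)) =
        -(κ * k) + 800 * κ ^ 2 * k := by linear_combination (-κ + 800 * κ ^ 2) * hpn
    rw [this, hsq]
    have := mul_le_mul_of_nonneg_left ht2 hκ0
    push_cast
    linarith
  have e2 : Real.exp (-(κ * ((ℓ : ℤ) : ℝ))) * (1 + 800 * κ ^ 2 * ((k : ℝ) / n)) ^ n ≤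
      Real.exp (-(t ^ 2 / (3200 * k))) := by
    refine (mul_le_mul_of_nonneg_left hC' (Real.exp_pos _).le).trans ?_
    rw [← Real.exp_add, Real.exp_le_exp]
    have : (n : ℝ) * (800 * κ ^ 2 * ((k : ℝ) / n)) = 800 * κ ^ 2 * k := by
      linear_combination (800 * κ ^ 2) * hpn
    rw [this, hsq]
    have := mul_le_mul_of_nonneg_left ht1 hκ0
    push_cast
    linarith
  linarith

/-! ### Stirling bounds and passage to uniform families -/

theorem factorial_le_stirling {n : ℕ} (hn : n ≠ 0) :
    (n.factorial : ℝ) ≤ Real.exp 1 * √n * (n / Real.exp 1) ^ n := by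
  obtain ⟨j, rfl⟩ := Nat.exists_eq_succ_of_ne_zero hn
  have h : Stirling.stirlingSeq (j + 1) ≤ Stirling.stirlingSeq 1 :=
    Stirling.stirlingSeq'_antitone (Nat.zero_le j)
  rw [Stirling.stirlingSeq_one, Stirling.stirlingSeq, div_le_iff₀ (by positivity)] at h
  refine h.trans (le_of_eq ?_)
  rw [Real.sqrt_mul (by norm_num)]
  field_simp

/-- Stirling bounds the layer's measure below by √(2πn)/(e²√(k(n-k))), and e² ≤ 3√(2π). -/
theorem binomial_weight_lower_bound {k n : ℕ} (hk : 0 < k) (hkn : k < n) :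
    1 ≤ 3 * √((k : ℝ) * (n - k) / n) *
      ((n.choose k : ℝ) * (((k : ℝ) / n) ^ k * (1 - (k : ℝ) / n) ^ (n - k))) := by
  obtain ⟨j, rfl⟩ := Nat.exists_eq_add_of_le hkn.le
  have hj : 0 < j := by omega
  have hkR : (0 : ℝ) < k := by exact_mod_cast hk
  have hjR : (0 : ℝ) < j := by exact_mod_cast hj
  have hchoose : ((k + j).choose k : ℝ) * (k.factorial * j.factorial) = (k + j).factorial := by
    have := Nat.choose_mul_factorial_mul_factorial (Nat.le_add_right k j)
    rw [Nat.add_sub_cancel_left] at this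
    rw [← mul_assoc]; exact_mod_cast this
  have hlow := Stirling.le_factorial_stirling (k + j)
  have hupp := mul_le_mul (factorial_le_stirling hk.ne') (factorial_le_stirling hj.ne')
    (by positivity) (by positivity)
  rw [Nat.add_sub_cancel_left]
  push_cast at hlow ⊢
  set N : ℝ := (k : ℝ) + j with hN
  have hNpos : 0 < N := by positivity
  rw [show N - k = j by rw [hN]; ring, show 1 - (k : ℝ) / N = j / N by
    rw [hN]; field_simp; ring]
  set e := Real.exp 1 with he
  have hepos : 0 < e := Real.exp_pos 1
  set M := ((k : ℝ) / e) ^ k * ((j : ℝ) / e) ^ j with hM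
  have hMpos : 0 < M := by positivity
  set w := ((k : ℝ) / N) ^ k * ((j : ℝ) / N) ^ j with hw
  have hwpos : 0 < w := by positivity
  have hMw : (N / e) ^ (k + j) * w = M := by
    rw [hw, hM, pow_add]
    simp only [div_pow]
    field_simp
  have h1 : √(2 * Real.pi * N) * M ≤
      ((k + j).choose k : ℝ) * w * (e ^ 2 * √((k : ℝ) * j)) * M := by
    calc √(2 * Real.pi * N) * M = √(2 * Real.pi * N) * (N / e) ^ (k + j) * w := by
          rw [← hMw]; ring
      _ ≤ (k + j).factorial * w := mul_le_mul_of_nonneg_right hlow hwpos.le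
      _ = ((k + j).choose k : ℝ) * w * (k.factorial * j.factorial) := by rw [← hchoose]; ring
      _ ≤ ((k + j).choose k : ℝ) * w * (e * √k * (k / e) ^ k * (e * √j * (j / e) ^ j)) :=
          mul_le_mul_of_nonneg_left hupp (by positivity)
      _ = _ := by rw [hM, Real.sqrt_mul hkR.le]; ring
  have h2 := le_of_mul_le_mul_right h1 hMpos
  have he4 : e ^ 2 ≤ 3 * √(2 * Real.pi) := by
    have hlt : e < 2.7182818286 := Real.exp_one_lt_d9
    have hle : e ^ 2 / 3 ≤ √(2 * Real.pi) := by
      refine Real.le_sqrt_of_sq_le ?_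
      have : e ^ 2 ≤ 7.39 := (pow_le_pow_left₀ hepos.le hlt.le 2).trans (by norm_num)
      nlinarith [Real.pi_gt_d2, sq_nonneg e]
    linarith
  have hsN : 0 < √N := Real.sqrt_pos.2 hNpos
  rw [Real.sqrt_mul (by positivity) N] at h2
  rw [Real.sqrt_div (by positivity)]
  have h3 : e ^ 2 * √N ≤ e ^ 2 * (3 * √((k : ℝ) * j) * (((k + j).choose k : ℝ) * w)) := by
    have := mul_le_mul_of_nonneg_right he4 hsN.le
    linarith
  have h4 := le_of_mul_le_mul_left h3 (by positivity)
  rw [mul_div_assoc', div_mul_eq_mul_div, le_div_iff₀ hsN, one_mul]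
  exact h4

theorem cubeMeasure_support_mem (p : ℝ) {k n : ℕ} (F : Finset (Finset (Fin n)))
    (hF : F ⊆ Finset.powersetCard k Finset.univ) :
    cubeMeasure p {x : Fin n → Bool | (Finset.univ.filter fun i => x i = true) ∈ F} =
      F.card * (p ^ k * (1 - p) ^ (n - k)) := by
  classical
  let φ : (Fin n → Bool) ≃ Finset (Fin n) :=
    { toFun := fun x => Finset.univ.filter fun i => x i = true
      invFun := fun A i => decide (i ∈ A)
      left_inv := fun x => by ext i; simp
      right_inv := fun A => by ext i; simp }
  unfold cubeMeasure
  rw [← φ.symm.sum_comp]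
  have hterm (A : Finset (Fin n)) :
      Set.indicator {x : Fin n → Bool | (Finset.univ.filter fun i => x i = true) ∈ F}
        (fun x => ∏ i, if x i then p else 1 - p) (φ.symm A) =
        if A ∈ F then p ^ k * (1 - p) ^ (n - k) else 0 := by
    have hA : (Finset.univ.filter fun i => φ.symm A i = true) = A := φ.apply_symm_apply A
    by_cases h : A ∈ F
    · have hcard : A.card = k := (Finset.mem_powersetCard.1 (hF h)).2
      have hmem : φ.symm A ∈
          {x : Fin n → Bool | (Finset.univ.filter fun i => x i = true) ∈ F} := by
        change (Finset.univ.filter fun i => φ.symm A i = true) ∈ F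
        rwa [hA]
      rw [Set.indicator_of_mem hmem, if_pos h, Finset.prod_ite, Finset.prod_const,
        Finset.prod_const, hA, hcard, Finset.filter_not, hA, ← Finset.compl_eq_univ_sdiff,
        Finset.card_compl, hcard, Fintype.card_fin]
    · have hmem : φ.symm A ∉
          {x : Fin n → Bool | (Finset.univ.filter fun i => x i = true) ∈ F} := by
        change ¬ (Finset.univ.filter fun i => φ.symm A i = true) ∈ F
        rwa [hA]
      rw [Set.indicator_of_notMem hmem, if_neg h]
  rw [Finset.sum_congr rfl fun A _ => hterm A, ← Finset.sum_filter, Finset.sum_const,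
    Finset.filter_mem_eq_inter, Finset.univ_inter, nsmul_eq_mul]

theorem commonCount_eq_card_inter {n : ℕ} (x y : Fin n → Bool) :
    commonCount x y = (((Finset.univ.filter fun i => x i = true) ∩
      (Finset.univ.filter fun i => y i = true)).card : ℤ) := by
  rw [← Finset.filter_and, commonCount]
  simp

theorem density_mul_density_le {ℓ k m n : ℕ} (hk : 0 < k) (hℓ : ℓ ≤ k) (hkm : k ≤ m)
    (hkn : 2 * k ≤ n) (hmn : m + k ≤ n) (F G : Finset (Finset (Fin n)))
    (hF : F ⊆ Finset.powersetCard k Finset.univ)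
    (hG : G ⊆ Finset.powersetCard m Finset.univ)
    (hFG : Forbid n {ℓ} F G) :
    ((F.card : ℝ) / (n.choose k : ℝ)) * ((G.card : ℝ) / (n.choose m : ℝ)) ≤
      50 * √((k : ℝ) * ((n : ℝ) - k) * m * ((n : ℝ) - m) / (n : ℝ) ^ 2) *
        Real.exp (-((min (ℓ : ℝ) ((k : ℝ) - ℓ)) ^ 2 / (58 ^ 2 * (k : ℝ)))) := by
  have hn : (0 : ℝ) < n := by exact_mod_cast (by omega : 0 < n)
  have hmn' : (m : ℝ) + k ≤ n := by exact_mod_cast hmn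
  have hk' : (0 : ℝ) < k := by exact_mod_cast hk
  have main := cubeMeasure_exceptional_mul_le_exp hk hℓ hkm hkn hmn
    {x : Fin n → Bool | (Finset.univ.filter fun i => x i = true) ∈ F}
  rw [cubeMeasure_support_mem _ F hF] at main
  have hsub : {y : Fin n → Bool | (Finset.univ.filter fun i => y i = true) ∈ G} ⊆
      exceptional {x : Fin n → Bool | (Finset.univ.filter fun i => x i = true) ∈ F} ℓ ℓ := by
    intro y hy x hx h
    refine hFG _ hx _ hy ?_
    rw [commonCount_eq_card_inter] at h
    rw [Set.mem_singleton_iff]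
    omega
  have hGm := cubeMeasure_mono (p := (m : ℝ) / n) (by positivity)
    (by rw [div_le_one hn]; linarith) hsub
  rw [cubeMeasure_support_mem _ G hG] at hGm
  have wF := binomial_weight_lower_bound hk (by omega : k < n)
  have wG := binomial_weight_lower_bound (by omega : 0 < m) (by omega : m < n)
  have hchoose {j : ℕ} (hj : j ≤ n) : (0 : ℝ) < n.choose j := by
    exact_mod_cast Nat.choose_pos hj
  have density {H : ℕ} {c s w : ℝ} (hc : 0 < c) (h : 1 ≤ 3 * s * (c * w)) :
      (H : ℝ) / c ≤ 3 * s * (H * w) := by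
    rw [div_le_iff₀ hc]
    calc (H : ℝ) = H * 1 := (mul_one _).symm
      _ ≤ H * (3 * s * (c * w)) := mul_le_mul_of_nonneg_left h (Nat.cast_nonneg H)
      _ = _ := by ring
  have dF := density (H := F.card) (hchoose (by omega)) wF
  have dG := density (H := G.card) (hchoose (by omega)) wG
  set wk := ((k : ℝ) / n) ^ k * (1 - (k : ℝ) / n) ^ (n - k) with hwk
  set wm := ((m : ℝ) / n) ^ m * (1 - (m : ℝ) / n) ^ (n - m) with hwm
  have hwk0 : 0 ≤ wk := by
    have : (0 : ℝ) ≤ 1 - (k : ℝ) / n := by rw [sub_nonneg, div_le_one hn]; linarith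
    positivity
  set t := min (ℓ : ℝ) ((k : ℝ) - ℓ) with ht
  have hprod : (G.card * wm) * (F.card * wk) ≤ 2 * Real.exp (-(t ^ 2 / (3200 * (k : ℝ)))) :=
    (mul_le_mul_of_nonneg_right hGm (by positivity)).trans main
  -- 3200 ≤ 58² = 3364.
  have hexp : Real.exp (-(t ^ 2 / (3200 * (k : ℝ)))) ≤
      Real.exp (-(t ^ 2 / (58 ^ 2 * (k : ℝ)))) := by
    rw [Real.exp_le_exp, neg_le_neg_iff]
    exact div_le_div_of_nonneg_left (sq_nonneg t) (by positivity)
      (mul_le_mul_of_nonneg_right (by norm_num) hk'.le)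
  have hsqrt : √((k : ℝ) * (n - k) / n) * √((m : ℝ) * (n - m) / n) =
      √((k : ℝ) * ((n : ℝ) - k) * m * ((n : ℝ) - m) / (n : ℝ) ^ 2) := by
    have : (0 : ℝ) ≤ (k : ℝ) * (n - k) / n :=
      div_nonneg (mul_nonneg hk'.le (by linarith)) hn.le
    rw [← Real.sqrt_mul this]
    congr 1
    field_simp
  rw [← hsqrt]
  set sk := √((k : ℝ) * (n - k) / n)
  set sm := √((m : ℝ) * (n - m) / n)
  have hs : 0 ≤ sk * sm := by positivity
  calc ((F.card : ℝ) / (n.choose k : ℝ)) * ((G.card : ℝ) / (n.choose m : ℝ))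
      ≤ (3 * sk * (F.card * wk)) * (3 * sm * (G.card * wm)) :=
        mul_le_mul dF dG (by positivity) (by positivity)
    _ = 9 * (sk * sm) * ((G.card * wm) * (F.card * wk)) := by ring
    _ ≤ 9 * (sk * sm) * (2 * Real.exp (-(t ^ 2 / (58 ^ 2 * (k : ℝ))))) :=
        mul_le_mul_of_nonneg_left (hprod.trans (by linarith)) (by positivity)
    _ ≤ 50 * (sk * sm) * Real.exp (-(t ^ 2 / (58 ^ 2 * (k : ℝ)))) := by
        have := mul_nonneg hs (Real.exp_pos (-(t ^ 2 / (58 ^ 2 * (k : ℝ))))).le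
        linarith

/-! ### Complementation and the final theorem -/

theorem forbid_compl {ℓ k n : ℕ} (hℓ : ℓ ≤ k) {F G : Finset (Finset (Fin n))}
    (hF : F ⊆ Finset.powersetCard k Finset.univ) (hFG : Forbid n {ℓ} F G) :
    Forbid n {k - ℓ} (G.image compl) F := by
  intro B' hB' A hA h
  obtain ⟨B, hB, rfl⟩ := Finset.mem_image.1 hB'
  refine hFG A hA B hB ?_
  rw [Set.mem_singleton_iff] at h ⊢
  have hcard : A.card = k := (Finset.mem_powersetCard.1 (hF hA)).2
  have hsplit := Finset.card_inter_add_card_sdiff A B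
  rw [Finset.inter_comm, ← Finset.sdiff_eq_inter_compl] at h
  omega

theorem proposition7p1 (ℓ k m n : ℕ) (hℓ : 0 < ℓ) (hℓk : ℓ ≤ k) (hkm : k ≤ m) (hmn : m ≤ n)
    (F G : Finset (Finset (Fin n)))
    (hF : F ⊆ Finset.powersetCard k Finset.univ)
    (hG : G ⊆ Finset.powersetCard m Finset.univ)
    (hFG : Forbid n {ℓ} F G) :
    ((k : ℝ) ≤ (n : ℝ) / 2 → (m : ℝ) ≤ (n : ℝ) - k →
      ((F.card : ℝ) / (n.choose k : ℝ)) * ((G.card : ℝ) / (n.choose m : ℝ)) ≤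
        50 * Real.sqrt ((k : ℝ) * ((n : ℝ) - k) * m * ((n : ℝ) - m) / (n : ℝ) ^ 2) *
          Real.exp (-((min (ℓ : ℝ) ((k : ℝ) - ℓ)) ^ 2 / (58 ^ 2 * (k : ℝ))))) ∧
    ((k : ℝ) ≤ (n : ℝ) / 2 → (n : ℝ) - k < m → (m : ℝ) ≤ (n : ℝ) - k + ℓ →
      ((F.card : ℝ) / (n.choose k : ℝ)) * ((G.card : ℝ) / (n.choose m : ℝ)) ≤
        50 * Real.sqrt ((k : ℝ) * ((n : ℝ) - k) * m * ((n : ℝ) - m) / (n : ℝ) ^ 2) *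
          Real.exp (-((min ((k : ℝ) - ℓ) ((n : ℝ) - m - ((k : ℝ) - ℓ))) ^ 2 /
            (58 ^ 2 * ((n : ℝ) - m))))) := by
  refine ⟨fun hk hm => ?_, fun hk hm hmℓ => ?_⟩
  · have hk' : 2 * k ≤ n := by
      have : 2 * (k : ℝ) ≤ n := by linarith
      exact_mod_cast this
    have hm' : m + k ≤ n := by
      have : (m : ℝ) + k ≤ n := by linarith
      exact_mod_cast this
    exact density_mul_density_le (by omega) hℓk hkm hk' hm' F G hF hG hFG
  · have hk' : 2 * k ≤ n := by
      have : 2 * (k : ℝ) ≤ n := by linarith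
      exact_mod_cast this
    have hm' : n < m + k := by
      have : (n : ℝ) < m + k := by linarith
      exact_mod_cast this
    have hmℓ' : m + k ≤ n + ℓ := by
      have : (m : ℝ) + k ≤ n + ℓ := by linarith
      exact_mod_cast this
    rcases hmn.eq_or_lt with rfl | hlt
    · have hempty : F = ∅ ∨ G = ∅ := by
        by_contra! h
        obtain ⟨⟨A, hA⟩, B, hB⟩ := h
        have hBu : B = Finset.univ :=
          (Finset.card_eq_iff_eq_univ B).1 <| by
            rw [Fintype.card_fin]; exact (Finset.mem_powersetCard.1 (hG hB)).2
        refine hFG A hA B hB ?_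
        rw [hBu, Finset.inter_univ, (Finset.mem_powersetCard.1 (hF hA)).2, Set.mem_singleton_iff]
        omega
      rcases hempty with rfl | rfl <;> simp
    · have hG' : G.image compl ⊆ Finset.powersetCard (n - m) Finset.univ := by
        intro B' hB'
        obtain ⟨B, hB, rfl⟩ := Finset.mem_image.1 hB'
        refine Finset.mem_powersetCard.2 ⟨Finset.subset_univ _, ?_⟩
        rw [Finset.card_compl, Fintype.card_fin, (Finset.mem_powersetCard.1 (hG hB)).2]
      -- The complements have size n - m < k, so they take the role of the smaller sets.
      have main := density_mul_density_le (by omega) (by omega) (by omega) (by omega) (by omega)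
        (G.image compl) F hG' hF (forbid_compl hℓk hF hFG)
      rw [Finset.card_image_of_injective G compl_injective, Nat.choose_symm hmn,
        Nat.cast_sub hmn, Nat.cast_sub hℓk, mul_comm] at main
      refine main.trans (le_of_eq ?_)
      congr 3
      ring
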